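/- Let $n\ge 3$. Let $\mathcal{ODP}_n$ be the monoid of all order-preserving partial isometries of $\{1,\ldots,n\}$, that is, of all injective partial maps $\alpha$ from $\{1,\ldots,n\}$ to itself such that, for all $i,j\in\mathrm{Dom}(\alpha)$, $i\le j$ implies $i\alpha\le j\alpha$, and $|i\alpha-j\alpha|=|i-j|$; maps are written on the right, so in a product the left factor is applied first. Consider the following elements of $\mathcal{ODP}_n$: for $1\le i\le n-2$, $x_i$ is the partial identity with domain $\{1,\ldots,n\}\setminus\{n-i\}$; $x_{n-1}$ is the map $j\mapsto j+1$ with domain $\{1,\ldots,n-1\}$; and $x_n$ is the map $j\mapsto j-1$ with domain $\{2,\ldots,n\}$. Let $A=\{x_1,\ldots,x_n\}$, regarded also as an alphabet, and let $R$ be the following set of relations between words over $A$: - $(R_1)$ $x_i^2=x_i$, for $1\le i\le n-2$; - $(R_2)$ $x_ix_j=x_jx_i$, for $1\le i<j\le n-2$; - $(R_3)$ $x_{n-1}x_i=x_{i+1}x_{n-1}$, for $1\le i\le n-3$; - $(R_4)$ $x_nx_{i+1}=x_ix_n$, for $1\le i\le n-3$; - $(R_5)$ $x_{n-1}^2x_n=x_1x_{n-1}$;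 - $(R_6)$ $x_nx_{n-1}^2=x_{n-1}x_{n-2}$; - $(R_7)$ $x_n^2x_{n-1}=x_{n-2}x_n$; - $(R_8)$ $x_{n-1}x_n^2=x_nx_1$; - $(R_9)$ $x_{n-1}x_nx_{n-1}=x_{n-1}$; - $(R_{10})$ $x_nx_{n-1}x_n=x_n$; - $(R_{11})$ $x_n^n=x_1\cdots x_{n-2}x_{n-1}x_{n-2}$; - $(R_{12})$ $x_n^{n+1}=x_n^n$. Then the monoid $\mathcal{ODP}_n$ is defined by the presentation $\langle A\mid R\rangle$: there is an isomorphism from the quotient $A^*/\rho_R$ of the free monoid $A^*$ by the smallest congruence $\rho_R$ containing $R$ onto $\mathcal{ODP}_n$, and it can be chosen to send the class of each letter $x_i$ to the element $x_i$. This presentation has exactly $n$ generators (the $n$ elements $x_1,\ldots,x_n$ are distinct) and exactly $\frac12n^2+\frac12n+3$ relations. -/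

import Mathlib

namespace PartialIsometry

/-- The chain `X_n = {1, …, n}`. -/
abbrev Pt (n : ℕ) : Type := Set.Icc 1 n

/-- The symmetric inverse monoid `I_n`: all partial permutations (injective partial maps)
of `{1, …, n}`. -/
abbrev SymInv (n : ℕ) : Type := Pt n ≃. Pt n

/-- The product of `I_n` is composition of partial maps, acting on the right:
`α * β` is first `α`, then `β`. -/
instance instMonoidSymInv (n : ℕ) : Monoid (SymInv n) where
  mul α β := α.trans β
  mul_assoc α β γ := PEquiv.trans_assoc α β γ
  one := PEquiv.refl (Pt n)
  one_mul α := PEquiv.refl_trans α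
  mul_one α := PEquiv.trans_refl α

theorem SymInv.mul_eq {n : ℕ} (α β : SymInv n) : α * β = α.trans β := rfl

theorem SymInv.one_eq {n : ℕ} : (1 : SymInv n) = PEquiv.refl (Pt n) := rfl

/-- `α` is order-preserving: `i ≤ j` implies `iα ≤ jα` for all `i, j` in the domain of `α`
(here `k ∈ α i` says that `i` is in the domain of `α` and `iα = k`). -/
def IsOrderPreserving {n : ℕ} (α : SymInv n) : Prop :=
  ∀ i j k l : Pt n, k ∈ α i → l ∈ α j → i ≤ j → k ≤ l

/-- `α` is a partial isometry: `|iα - jα| = |i - j|` for all `i, j` in the domain of `α`. -/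
def IsPartialIsometry {n : ℕ} (α : SymInv n) : Prop :=
  ∀ i j k l : Pt n, k ∈ α i → l ∈ α j →
    |((k : ℕ) : ℤ) - ((l : ℕ) : ℤ)| = |((i : ℕ) : ℤ) - ((j : ℕ) : ℤ)|

/-- The monoid `ODP_n` of all order-preserving partial isometries of `{1, …, n}`. -/
def ODP (n : ℕ) : Submonoid (SymInv n) where
  carrier := {α | IsOrderPreserving α ∧ IsPartialIsometry α}
  one_mem' := by
    constructor
    · intro i j k l hk hl hij
      rw [SymInv.one_eq, PEquiv.refl_apply, Option.mem_some_iff] at hk hl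
      rw [← hk, ← hl]
      exact hij
    · intro i j k l hk hl
      rw [SymInv.one_eq, PEquiv.refl_apply, Option.mem_some_iff] at hk hl
      rw [← hk, ← hl]
  mul_mem' := by
    rintro α β ⟨hα, hα'⟩ ⟨hβ, hβ'⟩
    constructor
    · intro i j k l hk hl hij
      rw [SymInv.mul_eq, PEquiv.mem_trans] at hk hl
      obtain ⟨p, hp, hk⟩ := hk
      obtain ⟨q, hq, hl⟩ := hl
      exact hβ p q k l hk hl (hα i j p q hp hq hij)
    · intro i j k l hk hl
      rw [SymInv.mul_eq, PEquiv.mem_trans] at hk hl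
      obtain ⟨p, hp, hk⟩ := hk
      obtain ⟨q, hq, hl⟩ := hl
      exact (hβ' p q k l hk hl).trans (hα' i j p q hp hq)

/-- The partial identity of `{1, …, n}` with domain `{1, …, n} \ {m}`. -/
def omit_pt (n m : ℕ) : SymInv n := PEquiv.ofSet {j : Pt n | (j : ℕ) ≠ m}

/-- The partial permutation `j ↦ j + 1` with domain `{1, …, n - 1}`. -/
def shiftUp (n : ℕ) : SymInv n where
  toFun j := if h : (j : ℕ) + 1 ≤ n then some ⟨j + 1, by omega, h⟩ else none
  invFun j := if h : 2 ≤ (j : ℕ) then some ⟨j - 1, by omega, by have := j.2.2; omega⟩ else none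
  inv := by
    rintro ⟨a, ha₁, ha₂⟩ ⟨b, hb₁, hb₂⟩
    simp only [Option.dite_none_right_eq_some, Option.some.injEq, Subtype.ext_iff]
    constructor
    · rintro ⟨h, h'⟩
      exact ⟨by omega, by omega⟩
    · rintro ⟨h, h'⟩
      exact ⟨by omega, by omega⟩

/-- The partial permutation `j ↦ j - 1` with domain `{2, …, n}`. -/
def shiftDown (n : ℕ) : SymInv n := (shiftUp n).symm

/-- The alphabet `A = {x_1, …, x_n}`: the letter `x_i` is represented by its index `i`. -/
abbrev Letter (n : ℕ) : Type := Set.Icc 1 n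

/-- The partial permutation named by the letter `x_i`: for `1 ≤ i ≤ n - 2` the partial identity
with domain `{1, …, n} \ {n - i}`, for `i = n - 1` the map `j ↦ j + 1`, and for `i = n` the map
`j ↦ j - 1`. -/
def gen (n : ℕ) (a : Letter n) : SymInv n :=
  if (a : ℕ) = n then shiftDown n
  else if (a : ℕ) = n - 1 then shiftUp n
  else omit_pt n (n - a)

/-- The letter `x_i`, for `1 ≤ i ≤ n`, as a one-letter word. -/
def x (n i : ℕ) (h : 1 ≤ i ∧ i ≤ n := by omega) : FreeMonoid (Letter n) :=
  FreeMonoid.of ⟨i, h⟩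

/-- The word `x_1 x_2 ⋯ x_{n-2}`. -/
def initialWord (n : ℕ) : FreeMonoid (Letter n) :=
  (List.ofFn fun j : Fin (n - 2) => x n (j + 1)).prod

/-- The relations `(R_1)`–`(R_12)` over the alphabet `A`, for `n ≥ 3`: `Rel n hn u v` says that
`u = v` is one of them. -/
inductive Rel (n : ℕ) (hn : 3 ≤ n) : FreeMonoid (Letter n) → FreeMonoid (Letter n) → Prop
  | R1 (i : ℕ) (h : 1 ≤ i ∧ i ≤ n - 2) : Rel n hn (x n i ^ 2) (x n i)
  | R2 (i j : ℕ) (h : 1 ≤ i ∧ i < j ∧ j ≤ n - 2) : Rel n hn (x n i * x n j) (x n j * x n i)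
  | R3 (i : ℕ) (h : 1 ≤ i ∧ i ≤ n - 3) :
      Rel n hn (x n (n - 1) * x n i) (x n (i + 1) * x n (n - 1))
  | R4 (i : ℕ) (h : 1 ≤ i ∧ i ≤ n - 3) : Rel n hn (x n n * x n (i + 1)) (x n i * x n n)
  | R5 : Rel n hn (x n (n - 1) ^ 2 * x n n) (x n 1 * x n (n - 1))
  | R6 : Rel n hn (x n n * x n (n - 1) ^ 2) (x n (n - 1) * x n (n - 2))
  | R7 : Rel n hn (x n n ^ 2 * x n (n - 1)) (x n (n - 2) * x n n)
  | R8 : Rel n hn (x n (n - 1) * x n n ^ 2) (x n n * x n 1)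
  | R9 : Rel n hn (x n (n - 1) * x n n * x n (n - 1)) (x n (n - 1))
  | R10 : Rel n hn (x n n * x n (n - 1) * x n n) (x n n)
  | R11 : Rel n hn (x n n ^ n) (initialWord n * x n (n - 1) * x n (n - 2))
  | R12 : Rel n hn (x n n ^ (n + 1)) (x n n ^ n)

/-- The relations of the presentation, as a set of pairs of words. -/
def relations (n : ℕ) (hn : 3 ≤ n) : Set (FreeMonoid (Letter n) × FreeMonoid (Letter n)) :=
  {p | Rel n hn p.1 p.2}

end PartialIsometry

/-!
In the presented monoid write `u` and `d` for the classes of `x_{n-1}` and `x_n`, and attach to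
every integer `m` an element `e_m` (`idem`) naming the partial identity that omits the point `m`:
a letter for `2 ≤ m ≤ n - 1`, the products `e_1 = d u` and `e_n = u d` at the two ends, and `1`
outside `{1, …, n}`. With these conventions the relations `Rel.R3`–`Rel.R10` become
the uniform rules `u e_m = e_{m-1} u` and `d e_m = e_{m+1} d`, for all integers `m` (`up_mul_idem`,
`down_mul_idem`). With `Rel.R1` and `Rel.R2`, all the `e_m` are commuting idempotents.
Hence every element is a product of some `e_m`, followed by a power of `u` or of `d`
(`exists_normalForm`).

A normal form names a shift restricted to a set of points. Pushing `e_{a+k} = 1` through the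
shift by `k` shows that a factor `e_a` may be inserted or removed whenever `a` or `a + k` lies
outside `{1, …, n}` (`idemProd_mul_shift_congr`), so a normal form whose map is nonempty is
determined by that map. The relations `Rel.R11` and `Rel.R12` make `e_1 ⋯ e_n` absorb `u` and `d` on
the right (`idemProd_allPts_mul_shift`), so all normal forms of the empty map agree as well. This
gives injectivity (`eval_injective`). Conversely, an order-preserving partial isometry is a shift
on its domain (`exists_isShiftOn`) and therefore has a normal form.

For the number of relations, the left-hand sides are pairwise distinct words, told apart by their
length and first three letters (`signature`).
-/

/-! ### The presented monoid -/

namespace PartialIsometry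

section Presented

variable {n : ℕ} {hn : 3 ≤ n}

variable (n hn) in
/-- The class of the letter `x_{n-1}`, which names the shift `j ↦ j + 1`. -/
def up : PresentedMonoid (Rel n hn) := PresentedMonoid.mk _ (x n (n - 1))

variable (n hn) in
/-- The class of the letter `x_n`, which names the shift `j ↦ j - 1`. -/
def down : PresentedMonoid (Rel n hn) := PresentedMonoid.mk _ (x n n)

variable (n hn) in
/-- The element of the presented monoid that names the partial identity omitting the point `m`.
For `2 ≤ m ≤ n - 1` it is a letter, for `m = 1` and `m = n` it is a product of the two shifts.
For every other integer `m` nothing is omitted and it is `1`. With this convention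
the commutation rules `up_mul_idem` and `down_mul_idem` hold for all integers. -/
def idem (m : ℤ) : PresentedMonoid (Rel n hn) :=
  if h : 2 ≤ m ∧ m ≤ n - 1 then PresentedMonoid.mk _ (x n (n - m).toNat)
  else if m = 1 then down n hn * up n hn
  else if m = n then up n hn * down n hn
  else 1

theorem idem_one : idem n hn 1 = down n hn * up n hn := by
  simp [idem]

theorem idem_last : idem n hn n = up n hn * down n hn := by
  rw [idem, dif_neg (by omega), if_neg (by omega), if_pos rfl]

theorem idem_of_out {m : ℤ} (h : m < 1 ∨ n < m) : idem n hn m = 1 := by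
  rw [idem, dif_neg (by omega), if_neg (by omega), if_neg (by omega)]

variable (n hn) in
theorem mk_x (i : ℕ) (h : 1 ≤ i ∧ i ≤ n - 2) :
    PresentedMonoid.mk (Rel n hn) (x n i) = idem n hn (n - i) := by
  rw [idem, dif_pos (by omega)]
  congr 2
  omega

theorem up_mul_down_mul_up : up n hn * down n hn * up n hn = up n hn := by
  simpa [up, down] using PresentedMonoid.mk_eq_mk_of_rel (Rel.R9 (hn := hn))

theorem down_mul_up_mul_down : down n hn * up n hn * down n hn = down n hn := by
  simpa [up, down] using PresentedMonoid.mk_eq_mk_of_rel (Rel.R10 (hn := hn))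

theorem up_mul_idem (m : ℤ) : up n hn * idem n hn m = idem n hn (m - 1) * up n hn := by
  rcases lt_or_ge m 1 with h | h
  · rw [idem_of_out (by omega), idem_of_out (by omega), mul_one, one_mul]
  rcases lt_or_ge (n + 1 : ℤ) m with h' | h'
  · rw [idem_of_out (by omega), idem_of_out (by omega), mul_one, one_mul]
  rcases eq_or_ne m 1 with rfl | h1
  · rw [idem_one, ← mul_assoc, up_mul_down_mul_up, idem_of_out (by omega), one_mul]
  rcases eq_or_ne m (n + 1) with rfl | h2
  · rw [idem_of_out (by omega), add_sub_cancel_right, idem_last, up_mul_down_mul_up, mul_one]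
  rcases eq_or_ne m n with rfl | h3
  · have := PresentedMonoid.mk_eq_mk_of_rel (Rel.R5 (hn := hn))
    simp only [map_mul, map_pow, mk_x n hn 1 (by omega)] at this
    rw [idem_last, ← mul_assoc, ← pow_two]
    exact this
  rcases eq_or_ne m 2 with rfl | h4
  · have := PresentedMonoid.mk_eq_mk_of_rel (Rel.R6 (hn := hn))
    simp only [map_mul, map_pow, mk_x n hn (n - 2) (by omega)] at this
    rw [show (2 - 1 : ℤ) = 1 by norm_num, idem_one, mul_assoc, ← pow_two]
    rw [show (n : ℤ) - ((n - 2 : ℕ) : ℤ) = 2 by omega] at this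
    exact this.symm
  · have hi : 1 ≤ (n - m).toNat ∧ (n - m).toNat ≤ n - 3 := by omega
    have := PresentedMonoid.mk_eq_mk_of_rel (Rel.R3 (hn := hn) (n - m).toNat hi)
    simp only [map_mul, mk_x n hn (n - m).toNat (by omega),
      mk_x n hn ((n - m).toNat + 1) (by omega)] at this
    rw [show (n : ℤ) - ((n - m).toNat : ℤ) = m by omega,
      show (n : ℤ) - (((n - m).toNat + 1 : ℕ) : ℤ) = m - 1 by omega] at this
    exact this

theorem down_mul_idem (m : ℤ) : down n hn * idem n hn m = idem n hn (m + 1) * down n hn := by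
  rcases lt_or_ge m 0 with h | h
  · rw [idem_of_out (by omega), idem_of_out (by omega), mul_one, one_mul]
  rcases lt_or_ge (n : ℤ) m with h' | h'
  · rw [idem_of_out (by omega), idem_of_out (by omega), mul_one, one_mul]
  rcases eq_or_ne m 0 with rfl | h1
  · rw [idem_of_out (by omega), zero_add, idem_one, down_mul_up_mul_down, mul_one]
  rcases eq_or_ne m n with rfl | h2
  · rw [idem_last, ← mul_assoc, down_mul_up_mul_down, idem_of_out (by omega), one_mul]
  rcases eq_or_ne m 1 with rfl | h3
  · have := PresentedMonoid.mk_eq_mk_of_rel (Rel.R7 (hn := hn))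
    simp only [map_mul, map_pow, mk_x n hn (n - 2) (by omega)] at this
    rw [idem_one, ← mul_assoc, ← pow_two, show (1 + 1 : ℤ) = 2 by norm_num]
    rw [show (n : ℤ) - ((n - 2 : ℕ) : ℤ) = 2 by omega] at this
    exact this
  rcases eq_or_ne m (n - 1) with rfl | h4
  · have := PresentedMonoid.mk_eq_mk_of_rel (Rel.R8 (hn := hn))
    simp only [map_mul, map_pow, mk_x n hn 1 (by omega)] at this
    rw [sub_add_cancel, idem_last, mul_assoc, ← pow_two]
    exact this.symm
  · have hi : 1 ≤ (n - 1 - m).toNat ∧ (n - 1 - m).toNat ≤ n - 3 := by omega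
    have := PresentedMonoid.mk_eq_mk_of_rel (Rel.R4 (hn := hn) (n - 1 - m).toNat hi)
    simp only [map_mul, mk_x n hn (n - 1 - m).toNat (by omega),
      mk_x n hn ((n - 1 - m).toNat + 1) (by omega)] at this
    rw [show (n : ℤ) - ((n - 1 - m).toNat : ℤ) = m + 1 by omega,
      show (n : ℤ) - (((n - 1 - m).toNat + 1 : ℕ) : ℤ) = m by omega] at this
    exact this

theorem idem_one_commute (m : ℤ) : Commute (idem n hn 1) (idem n hn m) := by
  rw [Commute, SemiconjBy, idem_one, mul_assoc, up_mul_idem, ← mul_assoc, down_mul_idem,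
    sub_add_cancel, mul_assoc]

theorem idem_last_commute (m : ℤ) : Commute (idem n hn n) (idem n hn m) := by
  rw [Commute, SemiconjBy, idem_last, mul_assoc, down_mul_idem, ← mul_assoc, up_mul_idem,
    add_sub_cancel_right, mul_assoc]

theorem idem_commute (m m' : ℤ) : Commute (idem n hn m) (idem n hn m') := by
  wlog hm : m' < m generalizing m m'
  · rcases (not_lt.1 hm).eq_or_lt with rfl | h
    · exact Commute.refl _
    · exact (this _ _ h).symm
  rcases lt_or_ge m' 1 with h | h
  · rw [idem_of_out (m := m') (by omega)]
    exact Commute.one_right _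
  rcases lt_or_ge (n : ℤ) m with h' | h'
  · rw [idem_of_out (m := m) (by omega)]
    exact Commute.one_left _
  rcases eq_or_ne m' 1 with rfl | h1
  · exact (idem_one_commute m).symm
  rcases eq_or_ne m n with rfl | h2
  · exact idem_last_commute m'
  · have := PresentedMonoid.mk_eq_mk_of_rel
      (Rel.R2 (hn := hn) (n - m).toNat (n - m').toNat (by omega))
    simp only [map_mul, mk_x n hn (n - m).toNat (by omega),
      mk_x n hn (n - m').toNat (by omega)] at this
    rw [show (n : ℤ) - ((n - m).toNat : ℤ) = m by omega,
      show (n : ℤ) - ((n - m').toNat : ℤ) = m' by omega] at this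
    exact this

theorem idem_mul_self (m : ℤ) : idem n hn m * idem n hn m = idem n hn m := by
  rcases lt_or_ge m 1 with h | h
  · rw [idem_of_out (by omega), mul_one]
  rcases lt_or_ge (n : ℤ) m with h' | h'
  · rw [idem_of_out (by omega), mul_one]
  rcases eq_or_ne m 1 with rfl | h1
  · rw [idem_one, ← mul_assoc, down_mul_up_mul_down]
  rcases eq_or_ne m n with rfl | h2
  · rw [idem_last, ← mul_assoc, up_mul_down_mul_up]
  · have := PresentedMonoid.mk_eq_mk_of_rel (Rel.R1 (hn := hn) (n - m).toNat (by omega))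
    simp only [map_pow, mk_x n hn (n - m).toNat (by omega)] at this
    rw [pow_two, show (n : ℤ) - ((n - m).toNat : ℤ) = m by omega] at this
    exact this

/-! ### Normal forms -/

variable (n hn) in
/-- The element naming the partial identity that omits all points of the list `l`. -/
def idemProd (l : List ℤ) : PresentedMonoid (Rel n hn) :=
  (l.map (idem n hn)).prod

theorem idemProd_nil : idemProd n hn [] = 1 := rfl

theorem idemProd_cons (a : ℤ) (l : List ℤ) :
    idemProd n hn (a :: l) = idem n hn a * idemProd n hn l := List.prod_cons

theorem idemProd_append (l l' : List ℤ) :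
    idemProd n hn (l ++ l') = idemProd n hn l * idemProd n hn l' := by
  rw [idemProd, List.map_append, List.prod_append]
  rfl

theorem idem_commute_idemProd (a : ℤ) (l : List ℤ) :
    Commute (idem n hn a) (idemProd n hn l) :=
  Commute.list_prod_right _ _ fun y hy => by
    obtain ⟨b, -, rfl⟩ := List.mem_map.1 hy
    exact idem_commute a b

theorem idemProd_commute (l l' : List ℤ) : Commute (idemProd n hn l) (idemProd n hn l') :=
  Commute.list_prod_left _ _ fun y hy => by
    obtain ⟨b, -, rfl⟩ := List.mem_map.1 hy
    exact idem_commute_idemProd b l'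

theorem idem_mul_idemProd_of_mem {a : ℤ} {l : List ℤ} (h : a ∈ l) :
    idem n hn a * idemProd n hn l = idemProd n hn l := by
  induction l with
  | nil => simp at h
  | cons b l ih =>
    rw [idemProd_cons]
    rcases List.mem_cons.1 h with rfl | h
    · rw [← mul_assoc, idem_mul_self]
    · rw [← mul_assoc, (idem_commute a b).eq, mul_assoc, ih h]

theorem up_mul_idemProd (l : List ℤ) :
    up n hn * idemProd n hn l = idemProd n hn (l.map (· - 1)) * up n hn := by
  induction l with
  | nil => simp [idemProd_nil]
  | cons a l ih =>
    rw [List.map_cons, idemProd_cons, idemProd_cons, ← mul_assoc, up_mul_idem, mul_assoc, ih,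
      mul_assoc]

theorem down_mul_idemProd (l : List ℤ) :
    down n hn * idemProd n hn l = idemProd n hn (l.map (· + 1)) * down n hn := by
  induction l with
  | nil => simp [idemProd_nil]
  | cons a l ih =>
    rw [List.map_cons, idemProd_cons, idemProd_cons, ← mul_assoc, down_mul_idem, mul_assoc, ih,
      mul_assoc]

variable (n hn) in
/-- The element naming the shift `j ↦ j + k` with the largest possible domain: a power of `up`
for `0 ≤ k`, a power of `down` for `k ≤ 0`. -/
def shift (k : ℤ) : PresentedMonoid (Rel n hn) :=
  up n hn ^ k.toNat * down n hn ^ (-k).toNat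

theorem shift_natCast (k : ℕ) : shift n hn k = up n hn ^ k := by
  simp [shift]

theorem shift_neg_natCast (k : ℕ) : shift n hn (-k) = down n hn ^ k := by
  simp [shift]

theorem shift_mul_idem (k m : ℤ) :
    shift n hn k * idem n hn m = idem n hn (m - k) * shift n hn k := by
  have hu (p : ℕ) (m : ℤ) : up n hn ^ p * idem n hn m = idem n hn (m - p) * up n hn ^ p := by
    induction p generalizing m with
    | zero => simp
    | succ p ih =>
      rw [pow_succ, mul_assoc, up_mul_idem, ← mul_assoc, ih, mul_assoc]
      congr 2
      push_cast
      ring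
  have hd (p : ℕ) (m : ℤ) : down n hn ^ p * idem n hn m = idem n hn (m + p) * down n hn ^ p := by
    induction p generalizing m with
    | zero => simp
    | succ p ih =>
      rw [pow_succ, mul_assoc, down_mul_idem, ← mul_assoc, ih, mul_assoc]
      congr 2
      push_cast
      ring
  rw [shift, mul_assoc, hd, ← mul_assoc, hu, mul_assoc]
  congr 2
  omega

/-- A point that the shift by `k` moves out of `{1, …, n}` may be omitted for free. -/
theorem idem_mul_shift_of_out {a k : ℤ} (h : a + k < 1 ∨ n < a + k) :
    idem n hn a * shift n hn k = shift n hn k := by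
  have := shift_mul_idem (n := n) (hn := hn) k (a + k)
  rw [add_sub_cancel_right, idem_of_out h, mul_one] at this
  exact this.symm

/-- Each factor `e_a` of `idemProd l` is absorbed: by a factor of `idemProd l'` if the shift by `k`
is defined at `a`, by the shift itself otherwise. -/
theorem idemProd_mul_shift_absorb {l l' : List ℤ} {k : ℤ}
    (h : ∀ a ∈ l, 1 ≤ a → a ≤ n → 1 ≤ a + k → a + k ≤ n → a ∈ l') :
    idemProd n hn l * (idemProd n hn l' * shift n hn k) = idemProd n hn l' * shift n hn k := by
  induction l with
  | nil => simp [idemProd_nil]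
  | cons a l ih =>
    rw [idemProd_cons, mul_assoc, ih fun b hb => h b (List.mem_cons_of_mem _ hb)]
    by_cases h₁ : a < 1 ∨ n < a
    · rw [idem_of_out h₁, one_mul]
    by_cases h₂ : a + k < 1 ∨ n < a + k
    · rw [← mul_assoc, (idem_commute_idemProd a l').eq, mul_assoc, idem_mul_shift_of_out h₂]
    · rw [← mul_assoc, idem_mul_idemProd_of_mem]
      exact h a List.mem_cons_self (by omega) (by omega) (by omega) (by omega)

/-- In a product `idemProd l * shift k`, only the points of `l` at which the shift is defined
matter. -/
theorem idemProd_mul_shift_congr {l l' : List ℤ} {k : ℤ}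
    (h : ∀ a : ℤ, 1 ≤ a → a ≤ n → 1 ≤ a + k → a + k ≤ n → (a ∈ l ↔ a ∈ l')) :
    idemProd n hn l * shift n hn k = idemProd n hn l' * shift n hn k := by
  rw [← idemProd_mul_shift_absorb (l := l) (l' := l') fun a ha h₁ h₂ h₃ h₄ =>
      (h a h₁ h₂ h₃ h₄).1 ha, ← mul_assoc, (idemProd_commute l l').eq, mul_assoc,
    idemProd_mul_shift_absorb fun a ha h₁ h₂ h₃ h₄ => (h a h₁ h₂ h₃ h₄).2 ha]

theorem up_mul_shift (k : ℤ) :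
    ∃ l : List ℤ, up n hn * shift n hn k = idemProd n hn l * shift n hn (k + 1) := by
  rcases lt_or_ge k 0 with h | h
  · obtain ⟨p, rfl⟩ : ∃ p : ℕ, k = -((p + 1 : ℕ) : ℤ) := ⟨(-k - 1).toNat, by omega⟩
    refine ⟨[n], ?_⟩
    rw [show -((p + 1 : ℕ) : ℤ) + 1 = -(p : ℤ) by push_cast; ring, shift_neg_natCast,
      shift_neg_natCast, pow_succ', ← mul_assoc, ← idem_last, idemProd_cons, idemProd_nil, mul_one]
  · obtain ⟨p, rfl⟩ : ∃ p : ℕ, k = p := ⟨k.toNat, by omega⟩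
    refine ⟨[], ?_⟩
    rw [show (p : ℤ) + 1 = (p + 1 : ℕ) by push_cast; ring, shift_natCast, shift_natCast, pow_succ',
      idemProd_nil, one_mul]

theorem down_mul_shift (k : ℤ) :
    ∃ l : List ℤ, down n hn * shift n hn k = idemProd n hn l * shift n hn (k - 1) := by
  rcases lt_or_ge 0 k with h | h
  · obtain ⟨p, rfl⟩ : ∃ p : ℕ, k = (p + 1 : ℕ) := ⟨(k - 1).toNat, by omega⟩
    refine ⟨[1], ?_⟩
    rw [show ((p + 1 : ℕ) : ℤ) - 1 = p by push_cast; ring, shift_natCast,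
      shift_natCast, pow_succ', ← mul_assoc, ← idem_one, idemProd_cons, idemProd_nil, mul_one]
  · obtain ⟨p, rfl⟩ : ∃ p : ℕ, k = -p := ⟨(-k).toNat, by omega⟩
    refine ⟨[], ?_⟩
    rw [show -(p : ℤ) - 1 = -(p + 1 : ℕ) by push_cast; ring, shift_neg_natCast, shift_neg_natCast,
      pow_succ', idemProd_nil, one_mul]

/-- The class of a letter: a shift by one or the omission of a point. -/
theorem of_letter (a : Letter n) :
    ((a : ℕ) = n ∧ PresentedMonoid.of (Rel n hn) a = down n hn) ∨
    ((a : ℕ) = n - 1 ∧ PresentedMonoid.of (Rel n hn) a = up n hn) ∨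
    ((a : ℕ) ≤ n - 2 ∧ PresentedMonoid.of (Rel n hn) a = idem n hn (n - (a : ℕ))) := by
  obtain ⟨i, h₁, h₂⟩ := a
  rcases eq_or_ne i n with rfl | h₃
  · exact .inl ⟨rfl, rfl⟩
  rcases eq_or_ne i (n - 1) with rfl | h₄
  · exact .inr (.inl ⟨rfl, rfl⟩)
  · exact .inr (.inr ⟨by simp only; omega, mk_x n hn i (by omega)⟩)

/-- Every element is an omission of points followed by a shift. -/
theorem exists_normalForm (p : PresentedMonoid (Rel n hn)) :
    ∃ (l : List ℤ) (k : ℤ), p = idemProd n hn l * shift n hn k := by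
  have hp : p ∈ Submonoid.closure (Set.range (PresentedMonoid.of (Rel n hn))) := by
    rw [PresentedMonoid.closure_range_of]
    trivial
  induction hp using Submonoid.closure_induction_left with
  | one => exact ⟨[], 0, by simp [idemProd_nil, shift]⟩
  | mul_left y hy q _ ih =>
    obtain ⟨a, rfl⟩ := hy
    obtain ⟨l, k, rfl⟩ := ih
    rcases of_letter (hn := hn) a with ⟨-, h⟩ | ⟨-, h⟩ | ⟨-, h⟩ <;> rw [h]
    · obtain ⟨l', h'⟩ := down_mul_shift (n := n) (hn := hn) k
      refine ⟨l.map (· + 1) ++ l', k - 1, ?_⟩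
      rw [← mul_assoc, down_mul_idemProd, mul_assoc, h', idemProd_append, mul_assoc]
    · obtain ⟨l', h'⟩ := up_mul_shift (n := n) (hn := hn) k
      refine ⟨l.map (· - 1) ++ l', k + 1, ?_⟩
      rw [← mul_assoc, up_mul_idemProd, mul_assoc, h', idemProd_append, mul_assoc]
    · refine ⟨(n - (a : ℕ)) :: l, k, ?_⟩
      rw [idemProd_cons, mul_assoc]

/-- All points of `{1, …, n}`. -/
def allPts (n : ℕ) : List ℤ := (List.range n).map fun i : ℕ => (i : ℤ) + 1

theorem mem_allPts {a : ℤ} : a ∈ allPts n ↔ 1 ≤ a ∧ a ≤ n := by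
  simp only [allPts, List.mem_map, List.mem_range]
  constructor
  · rintro ⟨i, hi, rfl⟩
    omega
  · intro h
    exact ⟨(a - 1).toNat, by omega, by omega⟩

/-- The class of `x_1 ⋯ x_{n-2}` omits the points `2, …, n - 1`. -/
theorem mk_initialWord : PresentedMonoid.mk (Rel n hn) (initialWord n) =
    idemProd n hn (List.ofFn fun j : Fin (n - 2) => (n : ℤ) - ((j : ℕ) + 1 : ℕ)) := by
  rw [initialWord, map_list_prod, idemProd, List.map_ofFn, List.map_ofFn]
  congr 2
  funext j
  exact mk_x n hn _ (by omega)

theorem mem_initialPts {a : ℤ} :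
    a ∈ (List.ofFn fun j : Fin (n - 2) => (n : ℤ) - ((j : ℕ) + 1 : ℕ)) ↔ 2 ≤ a ∧ a ≤ n - 1 := by
  rw [List.mem_ofFn]
  constructor
  · rintro ⟨j, rfl⟩
    omega
  · intro h
    exact ⟨⟨(n - 1 - a).toNat, by omega⟩, by simp only; omega⟩

/-- `Rel.R11` with its idempotents collected on the left. The factor `x_{n-2}` supplies the point
`1`, and the point `n` may be added because the shift up is undefined there. -/
theorem down_pow_eq_idemProd_mul_up :
    down n hn ^ n = idemProd n hn (allPts n) * up n hn := by
  have h := PresentedMonoid.mk_eq_mk_of_rel (Rel.R11 (hn := hn))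
  simp only [map_mul, map_pow, mk_x n hn (n - 2) (by omega), mk_initialWord] at h
  rw [show (n : ℤ) - ((n - 2 : ℕ) : ℤ) = 2 by omega] at h
  refine Eq.trans h ?_
  change _ * up n hn * _ = _
  rw [mul_assoc, up_mul_idem, ← mul_assoc, show (2 - 1 : ℤ) = 1 by norm_num,
    ← (idem_commute_idemProd _ _).eq, ← idemProd_cons]
  have h1 : up n hn = shift n hn 1 := by simp [shift]
  rw [h1]
  apply idemProd_mul_shift_congr
  intro a h₁ h₂ _ h₃
  rw [List.mem_cons, mem_initialPts, mem_allPts]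
  omega

theorem down_mul_pow : down n hn ^ n * down n hn = down n hn ^ n := by
  rw [← pow_succ]
  simpa [down] using PresentedMonoid.mk_eq_mk_of_rel (Rel.R12 (hn := hn))

/-- The element omitting all points is the zero of the monoid, here `x_n ^ n`. -/
theorem idemProd_allPts : idemProd n hn (allPts n) = down n hn ^ n := by
  rw [← down_mul_pow, down_pow_eq_idemProd_mul_up, mul_assoc, ← idem_last,
    ← (idem_commute_idemProd _ _).eq, idem_mul_idemProd_of_mem (mem_allPts.2 (by omega))]

theorem idemProd_allPts_mul_shift (k : ℤ) :
    idemProd n hn (allPts n) * shift n hn k = idemProd n hn (allPts n) := by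
  have hu (p : ℕ) : idemProd n hn (allPts n) * up n hn ^ p = idemProd n hn (allPts n) := by
    induction p with
    | zero => simp
    | succ p ih =>
      rw [pow_succ, ← mul_assoc, ih, ← down_pow_eq_idemProd_mul_up, idemProd_allPts]
  have hd (p : ℕ) : idemProd n hn (allPts n) * down n hn ^ p = idemProd n hn (allPts n) := by
    induction p with
    | zero => simp
    | succ p ih => rw [pow_succ, ← mul_assoc, ih, idemProd_allPts, down_mul_pow]
  rw [shift, ← mul_assoc, hu, hd]

/-- A normal form that is nowhere defined is the zero. -/
theorem idemProd_mul_shift_of_empty {l : List ℤ} {k : ℤ}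
    (h : ∀ a : ℤ, 1 ≤ a → a ≤ n → 1 ≤ a + k → a + k ≤ n → a ∈ l) :
    idemProd n hn l * shift n hn k = idemProd n hn (allPts n) := by
  rw [← idemProd_allPts_mul_shift k]
  apply idemProd_mul_shift_congr
  intro a h₁ h₂ h₃ h₄
  exact iff_of_true (h a h₁ h₂ h₃ h₄) (mem_allPts.2 ⟨h₁, h₂⟩)

end Presented

/-! ### The action on `{1, …, n}` -/

section Action

variable {n : ℕ}

/-- `α` is the shift `i ↦ i + k`, with domain the set of those points `i` that satisfy `S` and
for which `i + k` is again in `{1, …, n}`. Points are read as integers. -/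
def IsShiftOn (α : SymInv n) (S : ℤ → Prop) (k : ℤ) : Prop :=
  ∀ i j : Pt n, j ∈ α i ↔ S (i : ℕ) ∧ ((j : ℕ) : ℤ) = (i : ℕ) + k

namespace IsShiftOn

variable {α β : SymInv n} {S T : ℤ → Prop} {k l : ℤ}

/-- The domain of a product also requires the intermediate point `i + k` to lie in `{1, …, n}`. -/
theorem mul (hα : IsShiftOn α S k) (hβ : IsShiftOn β T l) :
    IsShiftOn (α * β) (fun i => S i ∧ 1 ≤ i + k ∧ i + k ≤ n ∧ T (i + k)) (k + l) := by
  intro i j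
  rw [SymInv.mul_eq, PEquiv.mem_trans]
  constructor
  · rintro ⟨p, h₁, h₂⟩
    obtain ⟨h₁, h₃⟩ := (hα i p).1 h₁
    obtain ⟨h₂, h₄⟩ := (hβ p j).1 h₂
    have := p.2.1
    have := p.2.2
    rw [h₃] at h₂
    exact ⟨⟨h₁, by omega, by omega, h₂⟩, by omega⟩
  · rintro ⟨⟨h₁, h₂, h₃, h₄⟩, h₅⟩
    refine ⟨⟨((i : ℕ) + k).toNat, by omega, by omega⟩, (hα _ _).2 ⟨h₁, ?_⟩,
      (hβ _ _).2 ⟨?_, ?_⟩⟩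
    · simp only
      omega
    · rwa [show (((((i : ℕ) : ℤ) + k).toNat : ℕ) : ℤ) = (i : ℕ) + k by omega]
    · simp only
      omega

theorem eq (hα : IsShiftOn α S k) (hβ : IsShiftOn β T k)
    (h : ∀ i : ℤ, 1 ≤ i → i ≤ n → 1 ≤ i + k → i + k ≤ n → (S i ↔ T i)) : α = β := by
  refine PEquiv.ext fun i => Option.ext fun j => (hα i j).trans (Iff.trans ?_ (hβ i j).symm)
  refine and_congr_left fun hj => ?_
  have := i.2.1
  have := i.2.2
  have := j.2.1
  have := j.2.2
  exact h _ (by omega) (by omega) (by omega) (by omega)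

theorem congr (hα : IsShiftOn α S k)
    (h : ∀ i : ℤ, 1 ≤ i → i ≤ n → 1 ≤ i + k → i + k ≤ n → (S i ↔ T i)) : IsShiftOn α T k := by
  intro i j
  refine (hα i j).trans (and_congr_left fun hj => ?_)
  have := i.2.1
  have := i.2.2
  have := j.2.1
  have := j.2.2
  exact h _ (by omega) (by omega) (by omega) (by omega)

theorem mem_ODP (hα : IsShiftOn α S k) : α ∈ ODP n := by
  constructor
  · intro i j p q hp hq hij
    have h₁ := ((hα _ _).1 hp).2
    have h₂ := ((hα _ _).1 hq).2
    have : (i : ℕ) ≤ j := hij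
    change (p : ℕ) ≤ q
    omega
  · intro i j p q hp hq
    rw [((hα _ _).1 hp).2, ((hα _ _).1 hq).2, add_sub_add_right_eq_sub]

theorem one : IsShiftOn (1 : SymInv n) (fun _ => True) 0 := by
  intro i j
  rw [SymInv.one_eq, PEquiv.refl_apply, Option.mem_some_iff, Subtype.ext_iff]
  lia

theorem omit_pt (m : ℕ) : IsShiftOn (omit_pt n m) (fun i => i ≠ m) 0 := by
  intro i j
  rw [PartialIsometry.omit_pt, PEquiv.mem_ofSet_iff, Set.mem_ofPred_eq, Subtype.ext_iff]
  omega

theorem shiftUp : IsShiftOn (shiftUp n) (fun _ => True) 1 := by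
  intro i j
  have := j.2.2
  simp only [PartialIsometry.shiftUp, PEquiv.coe_mk, Option.mem_def,
    Option.dite_none_right_eq_some, Option.some.injEq, Subtype.ext_iff]
  lia

theorem shiftDown : IsShiftOn (shiftDown n) (fun _ => True) (-1) := by
  intro i j
  rw [PartialIsometry.shiftDown, PEquiv.mem_iff_mem, shiftUp j i]
  lia

theorem shiftUp_pow (k : ℕ) : IsShiftOn (PartialIsometry.shiftUp n ^ k) (fun _ => True) k := by
  induction k with
  | zero => exact one
  | succ k ih =>
    rw [pow_succ, Nat.cast_succ]
    exact (ih.mul shiftUp).congr fun i _ _ _ _ => by lia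

theorem shiftDown_pow (k : ℕ) :
    IsShiftOn (PartialIsometry.shiftDown n ^ k) (fun _ => True) (-k) := by
  induction k with
  | zero => exact one
  | succ k ih =>
    rw [pow_succ, Nat.cast_succ, neg_add]
    exact (ih.mul shiftDown).congr fun i _ _ _ _ => by lia

/-- A product of maps that each omit one point, listed together with these points. -/
theorem list_prod (L : List (SymInv n × ℤ))
    (h : ∀ p ∈ L, IsShiftOn p.1 (fun i => i ≠ p.2) 0) :
    IsShiftOn (L.map Prod.fst).prod (fun i => i ∉ L.map Prod.snd) 0 := by
  induction L with
  | nil => exact one.congr fun i _ _ _ _ => by simp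
  | cons p L ih =>
    rw [List.map_cons, List.prod_cons]
    refine ((h p List.mem_cons_self).mul
      (ih fun q hq => h q (List.mem_cons_of_mem _ hq))).congr fun i h₁ h₂ _ _ => ?_
    rw [List.map_cons, List.mem_cons, not_or, add_zero]
    exact and_congr_right fun _ => ⟨fun h => h.2.2, fun h => ⟨h₁, h₂, h⟩⟩

end IsShiftOn

/-- A nonempty order-preserving partial isometry is a shift on its domain: the displacement of one
point of the domain determines that of all others. -/
theorem exists_isShiftOn {α : SymInv n} (hα : α ∈ ODP n) :
    ∃ (S : ℤ → Prop) (k : ℤ), IsShiftOn α S k := by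
  by_cases h : ∃ i j : Pt n, j ∈ α i
  · obtain ⟨i₀, j₀, h₀⟩ := h
    have key : ∀ i j : Pt n, j ∈ α i → ((j : ℕ) : ℤ) = (i : ℕ) + ((j₀ : ℕ) - (i₀ : ℕ)) := by
      intro i j hj
      have h₁ := hα.2 _ _ _ _ hj h₀
      rcases le_total i i₀ with h | h
      · have h₂ := hα.1 _ _ _ _ hj h₀ h
        have h₃ : (i : ℕ) ≤ i₀ := h
        have h₄ : (j : ℕ) ≤ j₀ := h₂
        rw [abs_of_nonpos (by omega), abs_of_nonpos (by omega)] at h₁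
        omega
      · have h₂ := hα.1 _ _ _ _ h₀ hj h
        have h₃ : (i₀ : ℕ) ≤ i := h
        have h₄ : (j₀ : ℕ) ≤ j := h₂
        rw [abs_of_nonneg (by omega), abs_of_nonneg (by omega)] at h₁
        omega
    refine ⟨fun a => ∃ i j : Pt n, ((i : ℕ) : ℤ) = a ∧ j ∈ α i, (j₀ : ℕ) - (i₀ : ℕ), ?_⟩
    intro i j
    constructor
    · intro hj
      exact ⟨⟨i, j, rfl, hj⟩, key i j hj⟩
    · rintro ⟨⟨i', j', h, hj'⟩, hj⟩
      obtain rfl : i' = i := Subtype.ext (by exact_mod_cast h)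
      obtain rfl : j' = j := Subtype.ext (by have := key _ _ hj'; omega)
      exact hj'
  · push Not at h
    exact ⟨fun _ => False, 0, fun i j => iff_of_false (h i j) (by simp)⟩

theorem gen_last (h : n ∈ Set.Icc 1 n) : gen n ⟨n, h⟩ = shiftDown n := if_pos rfl

theorem gen_pred (h : n - 1 ∈ Set.Icc 1 n) : gen n ⟨n - 1, h⟩ = shiftUp n := by
  have := h.1
  rw [gen, if_neg (by simp only; omega), if_pos rfl]

theorem gen_of_le {i : ℕ} (h : i ∈ Set.Icc 1 n) (h' : i ≤ n - 2) :
    gen n ⟨i, h⟩ = omit_pt n (n - i) := by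
  have := h.1
  rw [gen, if_neg (by simp only; omega), if_neg (by simp only; omega)]

/-- Evaluation of words in the symmetric inverse monoid. -/
def evalWord (n : ℕ) : FreeMonoid (Letter n) →* SymInv n := FreeMonoid.lift (gen n)

theorem evalWord_x_last (h : 1 ≤ n ∧ n ≤ n) : evalWord n (x n n h) = shiftDown n :=
  (FreeMonoid.lift_eval_of _ _).trans (gen_last h)

theorem evalWord_x_pred (h : 1 ≤ n - 1 ∧ n - 1 ≤ n) : evalWord n (x n (n - 1) h) = shiftUp n :=
  (FreeMonoid.lift_eval_of _ _).trans (gen_pred h)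

theorem isShiftOn_evalWord_x {i : ℕ} (h : 1 ≤ i ∧ i ≤ n) (h' : i ≤ n - 2) :
    IsShiftOn (evalWord n (x n i h)) (fun a => a ≠ n - i) 0 := by
  have e : evalWord n (x n i h) = omit_pt n (n - i) :=
    (FreeMonoid.lift_eval_of _ _).trans (gen_of_le h h')
  rw [e]
  exact (IsShiftOn.omit_pt _).congr fun a _ _ _ _ => by omega

theorem isShiftOn_evalWord_x_pred (h : 1 ≤ n - 1 ∧ n - 1 ≤ n) :
    IsShiftOn (evalWord n (x n (n - 1) h)) (fun _ => True) 1 := by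
  rw [evalWord_x_pred]
  exact .shiftUp

theorem isShiftOn_evalWord_x_last (h : 1 ≤ n ∧ n ≤ n) :
    IsShiftOn (evalWord n (x n n h)) (fun _ => True) (-1) := by
  rw [evalWord_x_last]
  exact .shiftDown

theorem isShiftOn_evalWord_initialWord :
    IsShiftOn (evalWord n (initialWord n)) (fun i => ¬(2 ≤ i ∧ i ≤ n - 1)) 0 := by
  have h := IsShiftOn.list_prod (n := n) (List.ofFn fun j : Fin (n - 2) =>
    (evalWord n (x n (j + 1)), (n : ℤ) - ((j : ℕ) + 1 : ℕ))) (by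
      intro p hp
      obtain ⟨j, rfl⟩ := List.mem_ofFn.1 hp
      exact isShiftOn_evalWord_x _ (by omega))
  rw [List.map_ofFn, List.map_ofFn] at h
  rw [initialWord, map_list_prod, List.map_ofFn]
  refine h.congr fun i _ _ _ _ => not_congr ?_
  exact mem_initialPts

/-- The generators satisfy the relations. -/
theorem evalWord_eq_of_rel {hn : 3 ≤ n} {v w : FreeMonoid (Letter n)} (h : Rel n hn v w) :
    evalWord n v = evalWord n w := by
  have u := isShiftOn_evalWord_x_pred (n := n) (by omega)
  have d := isShiftOn_evalWord_x_last (n := n) (by omega)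
  cases h <;> simp only [map_mul, map_pow, pow_two]
  case R1 i h =>
    have a := isShiftOn_evalWord_x (n := n) (i := i) (by omega) h.2
    exact (a.mul a).eq a fun _ _ _ _ _ => by lia
  case R2 i j h =>
    have a := isShiftOn_evalWord_x (n := n) (i := i) (by omega) (by omega)
    have b := isShiftOn_evalWord_x (n := n) (i := j) (by omega) (by omega)
    exact (a.mul b).eq (b.mul a) fun _ _ _ _ _ => by lia
  case R3 i h =>
    have a := isShiftOn_evalWord_x (n := n) (i := i) (by omega) (by omega)
    have b := isShiftOn_evalWord_x (n := n) (i := i + 1) (by omega) (by omega)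
    exact (u.mul a).eq (b.mul u) fun _ _ _ _ _ => by lia
  case R4 i h =>
    have a := isShiftOn_evalWord_x (n := n) (i := i) (by omega) (by omega)
    have b := isShiftOn_evalWord_x (n := n) (i := i + 1) (by omega) (by omega)
    exact (d.mul b).eq (a.mul d) fun _ _ _ _ _ => by lia
  case R5 =>
    have a := isShiftOn_evalWord_x (n := n) (i := 1) (by omega) (by omega)
    exact ((u.mul u).mul d).eq (a.mul u) fun _ _ _ _ _ => by lia
  case R6 =>
    have a := isShiftOn_evalWord_x (n := n) (i := n - 2) (by omega) (by omega)
    exact (d.mul (u.mul u)).eq (u.mul a) fun _ _ _ _ _ => by lia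
  case R7 =>
    have a := isShiftOn_evalWord_x (n := n) (i := n - 2) (by omega) (by omega)
    exact ((d.mul d).mul u).eq (a.mul d) fun _ _ _ _ _ => by lia
  case R8 =>
    have a := isShiftOn_evalWord_x (n := n) (i := 1) (by omega) (by omega)
    exact (u.mul (d.mul d)).eq (d.mul a) fun _ _ _ _ _ => by lia
  case R9 => exact ((u.mul d).mul u).eq u fun _ _ _ _ _ => by lia
  case R10 => exact ((d.mul u).mul d).eq d fun _ _ _ _ _ => by lia
  case R11 =>
    have a := isShiftOn_evalWord_x (n := n) (i := n - 2) (by omega) (by omega)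
    have b := ((isShiftOn_evalWord_initialWord (n := n)).mul u).mul a
    rw [evalWord_x_last]
    have c := IsShiftOn.shiftDown_pow (n := n) n
    -- Both sides are the empty map, so their displacements play no role.
    refine PEquiv.ext fun i => Option.ext fun j => (c i j).trans (Iff.trans ?_ (b i j).symm)
    have := i.2.1
    have := i.2.2
    have := j.2.1
    have := j.2.2
    omega
  case R12 =>
    rw [evalWord_x_last]
    have b := IsShiftOn.shiftDown_pow (n := n) n
    have c := IsShiftOn.shiftDown_pow (n := n) (n + 1)
    refine PEquiv.ext fun i => Option.ext fun j => (c i j).trans (Iff.trans ?_ (b i j).symm)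
    have := i.2.2
    have := j.2.1
    omega

end Action

/-! ### The isomorphism -/

section Isomorphism

variable {n : ℕ} {hn : 3 ≤ n}

variable (n hn) in
/-- The homomorphism from the presented monoid to the symmetric inverse monoid that evaluates
words. -/
def eval : PresentedMonoid (Rel n hn) →* SymInv n :=
  PresentedMonoid.lift (gen n) fun _ _ h => evalWord_eq_of_rel h

theorem isShiftOn_eval_idem (m : ℤ) : IsShiftOn (eval n hn (idem n hn m)) (fun i => i ≠ m) 0 := by
  have u : IsShiftOn (eval n hn (up n hn)) _ _ := isShiftOn_evalWord_x_pred (n := n) (by omega)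
  have d : IsShiftOn (eval n hn (down n hn)) _ _ := isShiftOn_evalWord_x_last (n := n) (by omega)
  rcases lt_or_ge m 1 with h | h
  · rw [idem_of_out (by omega), map_one]
    exact IsShiftOn.one.congr fun _ _ _ _ _ => by lia
  rcases lt_or_ge (n : ℤ) m with h' | h'
  · rw [idem_of_out (by omega), map_one]
    exact IsShiftOn.one.congr fun _ _ _ _ _ => by lia
  rcases eq_or_ne m 1 with rfl | h1
  · rw [idem_one, map_mul]
    exact (d.mul u).congr fun _ _ _ _ _ => by lia
  rcases eq_or_ne m n with rfl | h2
  · rw [idem_last, map_mul]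
    exact (u.mul d).congr fun _ _ _ _ _ => by lia
  · have h := mk_x n hn (n - m).toNat (by omega)
    rw [show (n : ℤ) - ((n - m).toNat : ℤ) = m by omega] at h
    rw [← h]
    have a : IsShiftOn (eval n hn (PresentedMonoid.mk _ (x n (n - m).toNat))) _ _ :=
      isShiftOn_evalWord_x (n := n) (i := (n - m).toNat) (by omega) (by omega)
    exact a.congr fun _ _ _ _ _ => by lia

theorem isShiftOn_eval_idemProd (l : List ℤ) :
    IsShiftOn (eval n hn (idemProd n hn l)) (fun i => i ∉ l) 0 := by
  have h := IsShiftOn.list_prod (n := n) (l.map fun m => (eval n hn (idem n hn m), m)) (by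
    intro p hp
    obtain ⟨m, -, rfl⟩ := List.mem_map.1 hp
    exact isShiftOn_eval_idem m)
  rw [List.map_map, List.map_map] at h
  rw [idemProd, map_list_prod, List.map_map]
  exact h.congr fun i _ _ _ _ => by
    rw [show (Prod.snd ∘ fun m => (eval n hn (idem n hn m), m)) = id from rfl, List.map_id]

theorem isShiftOn_eval_shift (k : ℤ) :
    IsShiftOn (eval n hn (shift n hn k)) (fun _ => True) k := by
  have hu : eval n hn (up n hn) = shiftUp n := evalWord_x_pred (by omega)
  have hd : eval n hn (down n hn) = shiftDown n := evalWord_x_last (by omega)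
  rcases le_total 0 k with h | h
  · obtain ⟨p, rfl⟩ : ∃ p : ℕ, k = p := ⟨k.toNat, by omega⟩
    rw [shift_natCast, map_pow, hu]
    exact .shiftUp_pow p
  · obtain ⟨p, rfl⟩ : ∃ p : ℕ, k = -p := ⟨(-k).toNat, by omega⟩
    rw [shift_neg_natCast, map_pow, hd]
    exact .shiftDown_pow p

theorem isShiftOn_eval_normalForm (l : List ℤ) (k : ℤ) :
    IsShiftOn (eval n hn (idemProd n hn l * shift n hn k)) (fun i => i ∉ l) k := by
  rw [map_mul]
  have h := (isShiftOn_eval_idemProd (hn := hn) l).mul (isShiftOn_eval_shift (hn := hn) k)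
  rw [zero_add] at h
  exact h.congr fun i h₁ h₂ _ _ => ⟨fun h => h.1, fun h => ⟨h, by omega, by omega, trivial⟩⟩

theorem eval_mem_ODP (p : PresentedMonoid (Rel n hn)) : eval n hn p ∈ ODP n := by
  obtain ⟨l, k, rfl⟩ := exists_normalForm p
  exact (isShiftOn_eval_normalForm l k).mem_ODP

/-- The map named by a normal form determines it: a nonempty map determines its displacement and
its domain, and all normal forms of the empty map are the zero. -/
theorem eval_injective : Function.Injective (eval n hn) := by
  intro p q h
  obtain ⟨l, k, rfl⟩ := exists_normalForm p
  obtain ⟨l', k', rfl⟩ := exists_normalForm q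
  have hp := isShiftOn_eval_normalForm (hn := hn) l k
  have hq := isShiftOn_eval_normalForm (hn := hn) l' k'
  rw [← h] at hq
  by_cases hE : ∃ i j : Pt n, j ∈ eval n hn (idemProd n hn l * shift n hn k) i
  · obtain ⟨i₀, j₀, h₀⟩ := hE
    obtain rfl : k = k' := by
      have h₁ := ((hp _ _).1 h₀).2
      have h₂ := ((hq _ _).1 h₀).2
      omega
    -- Evaluating both maps at `a ↦ a + k` compares membership of `a` in the two lists.
    refine idemProd_mul_shift_congr fun a h₁ h₂ h₃ h₄ => not_iff_not.1 ?_
    have h₅ := (hp ⟨a.toNat, by omega, by omega⟩ ⟨(a + k).toNat, by omega, by omega⟩).symm.trans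
      (hq ⟨a.toNat, by omega, by omega⟩ ⟨(a + k).toNat, by omega, by omega⟩)
    simp only [Int.toNat_of_nonneg (by omega : 0 ≤ a), Int.toNat_of_nonneg (by omega : 0 ≤ a + k),
      and_true] at h₅
    exact h₅
  · have key {m : List ℤ} {c : ℤ} (hm : IsShiftOn (eval n hn (idemProd n hn l * shift n hn k))
        (fun i => i ∉ m) c) : idemProd n hn m * shift n hn c = idemProd n hn (allPts n) := by
      refine idemProd_mul_shift_of_empty fun a h₁ h₂ h₃ h₄ => by_contra fun ha => hE ?_
      refine ⟨⟨a.toNat, by omega, by omega⟩, ⟨(a + c).toNat, by omega, by omega⟩,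
        (hm _ _).2 ⟨?_, ?_⟩⟩
      · rwa [Int.toNat_of_nonneg (by omega)]
      · simp only
        omega
    rw [key hp, key hq]

theorem exists_eval_eq {α : SymInv n} (hα : α ∈ ODP n) : ∃ p, eval n hn p = α := by
  classical
  obtain ⟨S, k, h⟩ := exists_isShiftOn hα
  refine ⟨idemProd n hn ((allPts n).filter fun i => ¬S i) * shift n hn k,
    (isShiftOn_eval_normalForm _ k).eq h fun i h₁ h₂ _ _ => ?_⟩
  simp [mem_allPts, h₁, h₂]

variable (n hn) in
/-- The isomorphism from the presented monoid onto the order-preserving partial isometries. -/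
noncomputable def evalEquiv : PresentedMonoid (Rel n hn) ≃* ODP n :=
  MulEquiv.ofBijective ((eval n hn).codRestrict (ODP n) eval_mem_ODP)
    ⟨fun _ _ h => eval_injective (congrArg Subtype.val h), fun α =>
      (exists_eval_eq (hn := hn) α.2).imp fun _ h => Subtype.ext h⟩

theorem coe_evalEquiv_of (a : Letter n) :
    (evalEquiv n hn (PresentedMonoid.of _ a) : SymInv n) = gen n a := rfl

end Isomorphism

/-! ### Counting generators and relations -/

section Counting

variable {n : ℕ} {hn : 3 ≤ n}

theorem isShiftOn_gen (hn : 3 ≤ n) (a : Letter n) :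
    IsShiftOn (gen n a) (fun i => n - 2 < (a : ℕ) ∨ i ≠ n - (a : ℕ))
      (if (a : ℕ) = n then -1 else if (a : ℕ) = n - 1 then 1 else 0) := by
  have h₁ := a.2.1
  have h₂ := a.2.2
  unfold gen
  split_ifs with h h'
  · exact IsShiftOn.shiftDown.congr fun _ _ _ _ _ => by lia
  · exact IsShiftOn.shiftUp.congr fun _ _ _ _ _ => by lia
  · exact (IsShiftOn.omit_pt _).congr fun _ _ _ _ _ => by lia

/-- The generators are told apart by the image of `1` and by the fixed points. -/
theorem gen_injective (hn : 3 ≤ n) : Function.Injective (gen n) := by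
  intro a b h
  have ha := isShiftOn_gen hn a
  have hb := isShiftOn_gen hn b
  rw [← h] at hb
  have := a.2.1
  have := a.2.2
  have := b.2.1
  have := b.2.2
  -- `1 ↦ 1` marks the partial identities and `1 ↦ 2` the shift up.
  have h₁ := (ha ⟨1, by omega, by omega⟩ ⟨1, by omega, by omega⟩).symm.trans (hb _ _)
  have h₂ := (ha ⟨1, by omega, by omega⟩ ⟨2, by omega, by omega⟩).symm.trans (hb _ _)
  apply Subtype.ext
  by_cases hl : (a : ℕ) ≤ n - 2
  · have h₃ := (ha ⟨n - a, by omega, by omega⟩ ⟨n - a, by omega, by omega⟩).symm.trans (hb _ _)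
    simp only at h₁ h₂ h₃
    split_ifs at h₁ h₂ h₃ <;> lia
  · simp only at h₁ h₂
    split_ifs at h₁ h₂ <;> lia

/-- The length and the first three letters of a word, with `0` for letters that do not exist.
This tells the left-hand sides of the relations apart. -/
def signature (w : FreeMonoid (Letter n)) : ℕ × ℕ × ℕ × ℕ :=
  let l := w.toList.map Subtype.val
  (l.length, l.getD 0 0, l.getD 1 0, l.getD 2 0)

theorem signature_x_pow {k i : ℕ} (h : 1 ≤ i ∧ i ≤ n) (hk : 3 ≤ k) :
    signature (x n i h ^ k) = (k, i, i, i) := by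
  have hl : ((x n i h ^ k).toList.map Subtype.val) = List.replicate k i := by
    clear hk
    induction k with
    | zero => rfl
    | succ k ih => rw [pow_succ', List.replicate_succ, ← ih]; rfl
  obtain ⟨m, rfl⟩ := Nat.exists_eq_add_of_le' hk
  simp [signature, hl, List.replicate_succ]

theorem signature_two {i j : ℕ} (h : 1 ≤ i ∧ i ≤ n) (h' : 1 ≤ j ∧ j ≤ n) :
    signature (x n i h * x n j h') = (2, i, j, 0) := rfl

theorem signature_three {i j k : ℕ} (h : 1 ≤ i ∧ i ≤ n) (h' : 1 ≤ j ∧ j ≤ n)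
    (h'' : 1 ≤ k ∧ k ≤ n) :
    signature (x n i h * x n j h' * x n k h'') = (3, i, j, k) := rfl

/-- The signature of the left-hand side determines the relation. -/
theorem eq_of_rel_of_signature_eq {u v u' v' : FreeMonoid (Letter n)} (h : Rel n hn u v)
    (h' : Rel n hn u' v') (e : signature u = signature u') : (u, v) = (u', v') := by
  cases h <;> cases h' <;>
    simp only [pow_two, ← mul_assoc, signature_two, signature_three, signature_x_pow _ hn,
      signature_x_pow _ (Nat.le_succ_of_le hn), Prod.mk.injEq] at e <;>
    first
    | rfl
    | omega
    | (obtain ⟨-, rfl, rfl, -⟩ := e; rfl)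
    | (obtain ⟨-, -, e, -⟩ := e
       first
       | subst e; rfl
       | obtain rfl := Nat.succ_injective e; rfl)

/-- The signatures of the left-hand sides of the relations. -/
def signatures (n : ℕ) : Finset (ℕ × ℕ × ℕ × ℕ) :=
  ((Finset.Icc 1 (n - 2)).sigma fun j => Finset.Icc 1 j).image (fun p => (2, p.2, p.1, 0)) ∪
  ((Finset.Icc 1 (n - 3)).image (fun i => (2, n - 1, i, 0)) ∪
  ((Finset.Icc 1 (n - 3)).image (fun i => (2, n, i + 1, 0)) ∪
  {(3, n - 1, n - 1, n), (3, n, n - 1, n - 1), (3, n, n, n - 1), (3, n - 1, n, n),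
    (3, n - 1, n, n - 1), (3, n, n - 1, n), (n, n, n, n), (n + 1, n, n, n)}))

theorem image_signature : (fun p => signature p.1) '' relations n hn = signatures n := by
  ext t
  simp only [signatures, Set.mem_image, relations, Set.mem_ofPred_eq, Prod.exists, Finset.coe_union,
    Set.mem_union, Finset.mem_coe, Finset.mem_image, Finset.mem_sigma, Finset.mem_Icc,
    Sigma.exists, Finset.mem_insert, Finset.mem_singleton]
  constructor
  · rintro ⟨u, v, h, rfl⟩
    cases h <;>
      simp only [pow_two, ← mul_assoc, signature_two, signature_three, signature_x_pow _ hn,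
        signature_x_pow _ (Nat.le_succ_of_le hn), Prod.mk.injEq]
    case R1 i h => exact .inl ⟨i, i, by lia⟩
    case R2 i j h => exact .inl ⟨j, i, by lia⟩
    case R3 i h => exact .inr (.inl ⟨i, by lia⟩)
    case R4 i h => exact .inr (.inr (.inl ⟨i, by lia⟩))
    all_goals exact .inr (.inr (.inr (by lia)))
  · rintro (⟨j, i, h, rfl⟩ | ⟨i, h, rfl⟩ | ⟨i, h, rfl⟩ | rfl | rfl | rfl | rfl | rfl | rfl | rfl |
      rfl)
    · rcases eq_or_ne i j with rfl | hij
      · exact ⟨_, _, .R1 i (by omega), rfl⟩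
      · exact ⟨_, _, .R2 i j (by omega), rfl⟩
    · exact ⟨_, _, .R3 i h, rfl⟩
    · exact ⟨_, _, .R4 i h, rfl⟩
    · exact ⟨_, _, .R5, rfl⟩
    · exact ⟨_, _, .R6, rfl⟩
    · exact ⟨_, _, .R7, rfl⟩
    · exact ⟨_, _, .R8, rfl⟩
    · exact ⟨_, _, .R9, rfl⟩
    · exact ⟨_, _, .R10, rfl⟩
    · exact ⟨_, _, .R11, signature_x_pow _ hn⟩
    · exact ⟨_, _, .R12, signature_x_pow _ (Nat.le_succ_of_le hn)⟩

theorem sum_Icc_id_mul_two (m : ℕ) : (∑ j ∈ Finset.Icc 1 m, j) * 2 = m * (m + 1) := by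
  induction m with
  | zero => rfl
  | succ m ih =>
    rw [Finset.sum_Icc_succ_top (by omega), add_mul, ih]
    ring

theorem card_signatures (hn : 3 ≤ n) :
    (signatures n).card = (∑ j ∈ Finset.Icc 1 (n - 2), j) + (2 * (n - 3) + 8) := by
  rw [signatures, Finset.card_union_of_disjoint, Finset.card_union_of_disjoint,
    Finset.card_union_of_disjoint, Finset.card_image_of_injOn, Finset.card_image_of_injOn,
    Finset.card_image_of_injOn, Finset.card_sigma]
  · have h8 : ({(3, n - 1, n - 1, n), (3, n, n - 1, n - 1), (3, n, n, n - 1), (3, n - 1, n, n),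
        (3, n - 1, n, n - 1), (3, n, n - 1, n), (n, n, n, n), (n + 1, n, n, n)} :
        Finset (ℕ × ℕ × ℕ × ℕ)).card = 8 := by
      repeat rw [Finset.card_insert_of_notMem (by
        simp only [Finset.mem_insert, Finset.mem_singleton, Prod.mk.injEq]; omega)]
      rw [Finset.card_singleton]
    simp only [h8, Nat.card_Icc, add_tsub_cancel_right]
    omega
  · intro i _ j _ h
    simpa using h
  · intro i _ j _ h
    simpa using h
  · rintro ⟨i, i'⟩ _ ⟨j, j'⟩ _ h
    simp only [Prod.mk.injEq] at h
    obtain ⟨-, rfl, rfl, -⟩ := h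
    rfl
  all_goals
    rw [Finset.disjoint_left]
    rintro ⟨a, b, c, d⟩ h h'
    simp only [Finset.mem_union, Finset.mem_image, Finset.mem_sigma, Finset.mem_Icc, Sigma.exists,
      Finset.mem_insert, Finset.mem_singleton, Prod.mk.injEq] at h h'
    grind

theorem ncard_relations : (relations n hn).ncard = (signatures n).card := by
  rw [← Set.ncard_coe_finset, ← image_signature (hn := hn), Set.InjOn.ncard_image]
  exact fun p h q h' e => eq_of_rel_of_signature_eq h h' e

end Counting

end PartialIsometry

/-- For `n ≥ 3`, `ODP_n` is defined by the presentation `⟨A | R⟩`, the letter `x_i` standing for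
the generator `x_i`; there are `n` generators and `n²/2 + n/2 + 3` relations. Mathlib's
`PresentedMonoid` is the quotient of the free monoid by the smallest congruence containing the
relations. -/
theorem mainTheorem1 (n : ℕ) (hn : 3 ≤ n) :
    (∃ e : PresentedMonoid (PartialIsometry.Rel n hn) ≃* PartialIsometry.ODP n,
      ∀ a : PartialIsometry.Letter n,
        (e (PresentedMonoid.of (PartialIsometry.Rel n hn) a) : PartialIsometry.SymInv n) =
          PartialIsometry.gen n a) ∧
    Nat.card (PartialIsometry.Letter n) = n ∧
    (Set.range (PartialIsometry.gen n)).ncard = n ∧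
    ((PartialIsometry.relations n hn).ncard : ℚ) = (n : ℚ) ^ 2 / 2 + (n : ℚ) / 2 + 3 := by
  refine ⟨⟨PartialIsometry.evalEquiv n hn, PartialIsometry.coe_evalEquiv_of⟩, ?_, ?_, ?_⟩
  · simp
  · rw [Set.ncard_range_of_injective (PartialIsometry.gen_injective hn)]
    simp
  · rw [PartialIsometry.ncard_relations, PartialIsometry.card_signatures hn]
    obtain ⟨m, rfl⟩ := Nat.exists_eq_add_of_le' hn
    have h := PartialIsometry.sum_Icc_id_mul_two (m + 3 - 2)
    rw [show m + 3 - 2 = m + 1 by omega] at h ⊢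
    rw [show m + 3 - 3 = m by omega]
    have h' : ((∑ j ∈ Finset.Icc 1 (m + 1), j : ℕ) : ℚ) * 2 = (m + 1) * (m + 1 + 1) := by
      exact_mod_cast h
    push_cast at h' ⊢
    linarith
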